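/- All groups are countable, and a countable group is given a proper left-invariant metric (such a metric exists, and any two of them are coarsely equivalent), so that its asymptotic dimension is well defined. For $g$ in a group $G$ let $C_g=\{h\in G : hg=gh\}$ be its centralizer. We say that $G$ satisfies the centralizer conjecture if the following implication holds: if $G$ has finite asymptotic dimension, then for every $g\in G$ the quotient $C_g/\langle g\rangle$ also has finite asymptotic dimension. 1. Let $G$ be a countable group of finite asymptotic dimension that satisfies the centralizer conjecture. Then every subgroup of $G$ satisfies the centralizer conjecture. 2. Let $(H_i)_{i\in I}$ be a (finite or infinite) family of groups, each of which satisfies the centralizer conjecture, such that the free product $G=\ast_{i\in I}H_i$ is countable. Then $G$ satisfies the centralizer conjecture. 3. Let $1\to K\to G\to Q\to 1$ be an exact sequence of groups with $G$ countable and with $Q$ of finite asymptotic dimension. If $K$ and $Q$ satisfy the centralizer conjecture, then so does $G$. -/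

import Mathlib

/-- `AsdimLE X n`: the metric space `X` has asymptotic dimension at most `n`. For every `r` there
are `n + 1` families of subsets, together covering `X`, such that all members have diameter at most
a common bound `D` and distinct members of the same family are at distance more than `r`. -/
def AsdimLE (X : Type*) [PseudoMetricSpace X] (n : ℕ) : Prop :=
  ∀ r : ℝ, ∃ (D : ℝ) (U : Fin (n + 1) → Set (Set X)),
    (∀ x : X, ∃ i, ∃ A ∈ U i, x ∈ A) ∧
    (∀ i, ∀ A ∈ U i, ∀ x ∈ A, ∀ y ∈ A, dist x y ≤ D) ∧
    (∀ i, ∀ A ∈ U i, ∀ B ∈ U i, A ≠ B → ∀ x ∈ A, ∀ y ∈ B, r < dist x y)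

/-- A left-invariant metric on a group that is proper for the discrete topology:
all balls are finite. -/
structure IsProperLeftInvariant (G : Type*) [Group G] [MetricSpace G] : Prop where
  dist_mul_left : ∀ g x y : G, dist (g * x) (g * y) = dist x y
  finite_closedBall : ∀ (x : G) (r : ℝ), (Metric.closedBall x r).Finite

/-- A (countable) group has finite asymptotic dimension if it does for a proper left-invariant
metric. Such metrics exist on countable groups (`exists_isProperLeftInvariant`), and the choice
does not matter (`asdimLE_of_isProperLeftInvariant`). -/
def GroupFiniteAsdim (G : Type*) [Group G] : Prop :=
  ∃ _ : MetricSpace G, IsProperLeftInvariant G ∧ ∃ n : ℕ, AsdimLE G n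

/-- The cyclic subgroup `⟨g⟩`, as a subgroup of the centralizer `C_g` of `g`. -/
def cyclicInCentralizer {G : Type*} [Group G] (g : G) :
    Subgroup (Subgroup.centralizer ({g} : Set G)) :=
  (Subgroup.zpowers g).subgroupOf (Subgroup.centralizer {g})

instance cyclicInCentralizer_normal {G : Type*} [Group G] (g : G) :
    (cyclicInCentralizer g).Normal where
  conj_mem := by
    rintro ⟨n, hn⟩ h ⟨c, hc⟩
    obtain ⟨k, rfl⟩ := Subgroup.mem_zpowers_iff.mp (Subgroup.mem_subgroupOf.mp h)
    have hcg : Commute c g := (Subgroup.mem_centralizer_singleton_iff.mp hc)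
    refine Subgroup.mem_subgroupOf.mpr ?_
    have h2 : c * g ^ k * c⁻¹ = g ^ k := by
      rw [(hcg.zpow_right k).eq, mul_inv_cancel_right]
    simp [h2]

/-- The reduced centralizer `C_g / ⟨g⟩`. -/
abbrev ReducedCentralizer {G : Type*} [Group G] (g : G) : Type _ :=
  (Subgroup.centralizer ({g} : Set G)) ⧸ cyclicInCentralizer g

/-- `G` satisfies the conjecture on reduced centralizers: if `G` has finite asymptotic dimension,
then so does `C_g / ⟨g⟩` for every `g`. -/
def SatisfiesCentralizerConjecture (G : Type*) [Group G] : Prop :=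
  GroupFiniteAsdim G → ∀ g : G, GroupFiniteAsdim (ReducedCentralizer g)

/-- Asymptotic dimension does not depend on the proper left-invariant metric. -/
theorem asdimLE_of_isProperLeftInvariant {G : Type*} [Group G] (m m' : MetricSpace G)
    (hm : @IsProperLeftInvariant G _ m) (hm' : @IsProperLeftInvariant G _ m') (n : ℕ)
    (h : @AsdimLE G m.toPseudoMetricSpace n) : @AsdimLE G m'.toPseudoMetricSpace n := by
  have key : ∀ (m m' : MetricSpace G), @IsProperLeftInvariant G _ m →
      @IsProperLeftInvariant G _ m' → ∀ r : ℝ, ∃ s : ℝ, ∀ x y : G,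
        m.dist x y ≤ r → m'.dist x y ≤ s := by
    intro m m' hm hm' r
    obtain ⟨s, hs⟩ := ((@IsProperLeftInvariant.finite_closedBall G _ m hm 1 r).image
      (fun y => m'.dist y 1)).bddAbove
    refine ⟨s, fun x y hxy => ?_⟩
    have h1 : m.dist (y⁻¹ * x) 1 ≤ r := by
      have := @IsProperLeftInvariant.dist_mul_left G _ m hm y⁻¹ x y
      rw [inv_mul_cancel] at this
      exact this.le.trans hxy
    have h2 : m'.dist (y⁻¹ * x) 1 ≤ s := hs ⟨_, h1, rfl⟩
    have := @IsProperLeftInvariant.dist_mul_left G _ m' hm' y⁻¹ x y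
    rw [inv_mul_cancel] at this
    exact this.symm.le.trans h2
  intro r
  obtain ⟨s, hs⟩ := key m' m hm' hm r
  obtain ⟨D, U, h1, h2, h3⟩ := h s
  obtain ⟨D', hD'⟩ := key m m' hm hm' D
  refine ⟨D', U, h1, fun i A hA x hx y hy => hD' x y (h2 i A hA x hx y hy), ?_⟩
  intro i A hA B hB hAB x hx y hy
  by_contra hlt
  exact absurd (hs x y (not_lt.mp hlt)) (not_le.mpr (h3 i A hA B hB hAB x hx y hy))

/-- Every countable group carries a proper left-invariant metric. -/
theorem exists_isProperLeftInvariant (G : Type*) [Group G] [Countable G] :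
    ∃ _ : MetricSpace G, IsProperLeftInvariant G := by
  classical
  obtain ⟨e, he⟩ := exists_injective_nat G
  let w : G → ℕ := fun g => e g + e g⁻¹ + 1
  let W : List G → ℕ := fun l => (l.map w).sum
  have hex : ∀ g : G, ∃ n, ∃ l : List G, l.prod = g ∧ W l = n := fun g => ⟨_, [g], by simp, rfl⟩
  let L : G → ℕ := fun g => Nat.find (hex g)
  have hL : ∀ g, ∃ l : List G, l.prod = g ∧ W l = L g := fun g => Nat.find_spec (hex g)
  have hLle : ∀ l : List G, L l.prod ≤ W l := fun l => Nat.find_min' (hex _) ⟨l, rfl, rfl⟩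
  have hL1 : L 1 = 0 := by
    have := hLle []
    simpa [W] using this
  have hL0 : ∀ g, L g = 0 → g = 1 := by
    intro g hg
    obtain ⟨l, hl, hl'⟩ := hL g
    rw [hg] at hl'
    cases l with
    | nil => simpa using hl.symm
    | cons a l => simp [W, w] at hl'
  have hmul : ∀ g h, L (g * h) ≤ L g + L h := by
    intro g h
    obtain ⟨l, hl, hl'⟩ := hL g
    obtain ⟨k, hk, hk'⟩ := hL h
    have := hLle (l ++ k)
    rw [List.prod_append, hl, hk] at this
    rw [← hl', ← hk']
    simpa [W] using this
  have hinv' : ∀ g, L g⁻¹ ≤ L g := by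
    intro g
    obtain ⟨l, hl, hl'⟩ := hL g
    have := hLle (l.map (fun x => x⁻¹)).reverse
    rw [← List.prod_inv_reverse, hl] at this
    refine this.trans (le_of_eq ?_)
    rw [← hl']
    simp only [W, List.map_reverse, List.sum_reverse, List.map_map]
    congr 1
    refine List.map_congr_left fun x _ => ?_
    simp [w, add_comm]
  have hinv : ∀ g, L g⁻¹ = L g := fun g =>
    le_antisymm (hinv' g) (by simpa using hinv' g⁻¹)
  have hletter : ∀ n : ℕ, {g : G | w g ≤ n}.Finite := by
    intro n
    refine Set.Finite.of_finite_image (f := e) ((Set.finite_Iic n).subset ?_) he.injOn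
    rintro _ ⟨g, hg, rfl⟩
    have : e g + e g⁻¹ + 1 ≤ n := hg
    exact Set.mem_Iic.mpr (by omega)
  have hfin : ∀ n : ℕ, {g : G | ∃ l : List G, l.prod = g ∧ W l ≤ n}.Finite := by
    intro n
    induction n with
    | zero =>
      refine (Set.finite_singleton (1 : G)).subset ?_
      rintro g ⟨l, hl, hl'⟩
      cases l with
      | nil => simpa using hl.symm
      | cons a l => simp [W, w] at hl'
    | succ n ih =>
      refine ((Set.finite_singleton (1 : G)).union
        (Set.Finite.image2 (fun a b => a * b) (hletter (n + 1)) ih)).subset ?_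
      rintro g ⟨l, hl, hl'⟩
      cases l with
      | nil => exact Or.inl (by simpa using hl.symm)
      | cons a l =>
        have h1 : w a + W l ≤ n + 1 := by simpa [W] using hl'
        have h2 : 1 ≤ w a := Nat.le_add_left 1 _
        refine Or.inr ⟨a, ?_, l.prod, ⟨l, rfl, by omega⟩, by simpa using hl⟩
        change w a ≤ n + 1
        omega
  let m : MetricSpace G :=
    { dist := fun x y => (L (x⁻¹ * y) : ℝ)
      dist_self := fun x => by simp [hL1]
      dist_comm := fun x y => by
        have := hinv (x⁻¹ * y)
        rw [mul_inv_rev, inv_inv] at this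
        simp [this]
      dist_triangle := fun x y z => by
        have := hmul (x⁻¹ * y) (y⁻¹ * z)
        rw [mul_assoc, mul_inv_cancel_left] at this
        exact_mod_cast this
      eq_of_dist_eq_zero := fun {x y} h => by
        have h' : L (x⁻¹ * y) = 0 := by exact_mod_cast h
        exact (inv_mul_eq_one.mp (hL0 _ h')) }
  refine ⟨m, ⟨fun g x y => ?_, fun x r => ?_⟩⟩
  · change (L ((g * x)⁻¹ * (g * y)) : ℝ) = L (x⁻¹ * y)
    congr 2
    group
  · refine ((hfin ⌊r⌋₊).image (fun g => x * g⁻¹)).subset ?_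
    intro y hy
    have hy' : (L (y⁻¹ * x) : ℝ) ≤ r := hy
    obtain ⟨l, hl, hl'⟩ := hL (y⁻¹ * x)
    exact ⟨y⁻¹ * x, ⟨l, hl, by rw [hl']; exact Nat.le_floor hy'⟩, by simp⟩

/-! Finite asymptotic dimension passes to subgroups and to extensions (`GroupFiniteAsdim.of_ker`);
only finiteness matters, so crude bounds suffice. An injective homomorphism induces an injection of
reduced centralizers, which settles subgroups.

For an extension, let `q` be the image of `g`. The kernel of `C_g/⟨g⟩ → C_q/⟨q⟩` is represented by
elements of `K ∩ C_g`, modulo `K ∩ ⟨g⟩`. The latter is cyclic, say `⟨k⟩`, and `K ∩ C_g` centralizes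
`k`, so the kernel embeds in the reduced centralizer of `k` in `K`.

In a free product, `g` is up to conjugacy trivial, in a factor, or cyclically reduced
(`exists_conj_eq`). A nontrivial element of a factor has its centralizer inside that factor. If `g`
is the product of a cyclically reduced word, every element commuting with it is a power of `g` times
a prefix product (`IsCyclicallyReduced.isPowMulPrefix`), so `C_g/⟨g⟩` is finite. -/

/-! ### Permanence of finite asymptotic dimension -/

/-- A family of covers indexed by a finite type bounds the asymptotic dimension. -/
theorem AsdimLE.of_fintype {X : Type*} [PseudoMetricSpace X] (ι : Type*) [Fintype ι] [Nonempty ι]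
    (h : ∀ r : ℝ, ∃ (D : ℝ) (U : ι → Set (Set X)),
      (∀ x : X, ∃ i, ∃ A ∈ U i, x ∈ A) ∧
      (∀ i, ∀ A ∈ U i, ∀ x ∈ A, ∀ y ∈ A, dist x y ≤ D) ∧
      (∀ i, ∀ A ∈ U i, ∀ B ∈ U i, A ≠ B → ∀ x ∈ A, ∀ y ∈ B, r < dist x y)) :
    AsdimLE X (Fintype.card ι - 1) := by
  intro r
  obtain ⟨D, U, h1, h2, h3⟩ := h r
  have e : ι ≃ Fin (Fintype.card ι - 1 + 1) :=
    (Fintype.equivFin ι).trans (finCongr (Nat.sub_add_cancel Fintype.card_pos).symm)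
  refine ⟨D, fun i => U (e.symm i), fun x => ?_, fun i => h2 _, fun i => h3 _⟩
  obtain ⟨i, hi⟩ := h1 x
  exact ⟨e i, by simpa using hi⟩

/-- Asymptotic dimension is monotone under isometric embeddings. -/
theorem AsdimLE.of_isometry {X Y : Type*} [PseudoMetricSpace X] [PseudoMetricSpace Y] {n : ℕ}
    (h : AsdimLE Y n) (f : X → Y) (hf : ∀ x y, dist (f x) (f y) = dist x y) : AsdimLE X n := by
  intro r
  obtain ⟨D, U, h1, h2, h3⟩ := h r
  refine ⟨D, fun i => (fun A => f ⁻¹' A) '' U i, fun x => ?_, ?_, ?_⟩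
  · obtain ⟨i, A, hA, hx⟩ := h1 (f x)
    exact ⟨i, _, ⟨A, hA, rfl⟩, hx⟩
  · rintro i _ ⟨A, hA, rfl⟩ x hx y hy
    exact (hf x y).symm.le.trans (h2 i A hA _ hx _ hy)
  · rintro i _ ⟨A, hA, rfl⟩ _ ⟨B, hB, rfl⟩ hAB x hx y hy
    exact (h3 i A hA B hB (fun h => hAB (by rw [h])) _ hx _ hy).trans_eq (hf x y)

theorem GroupFiniteAsdim.exists_asdimLE {G : Type*} [Group G] (h : GroupFiniteAsdim G)
    [m : MetricSpace G] (hm : IsProperLeftInvariant G) : ∃ n, AsdimLE G n := by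
  obtain ⟨m', hm', n, hn⟩ := h
  exact ⟨n, asdimLE_of_isProperLeftInvariant m' m hm' hm n hn⟩

theorem IsProperLeftInvariant.induced {G H : Type*} [Group G] [Group H] [m : MetricSpace H]
    (hm : IsProperLeftInvariant H) (f : G →* H) (hf : Function.Injective f) :
    @IsProperLeftInvariant G _ (MetricSpace.induced f hf m) := by
  let := MetricSpace.induced f hf m
  refine ⟨fun g x y => ?_, fun x r => ?_⟩
  · change dist (f (g * x)) (f (g * y)) = dist (f x) (f y)
    rw [map_mul, map_mul, hm.dist_mul_left]
  · exact (hm.finite_closedBall (f x) r).preimage hf.injOn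

/-- Finiteness of asymptotic dimension passes to subgroups. -/
theorem GroupFiniteAsdim.of_injective {G H : Type*} [Group G] [Group H] (h : GroupFiniteAsdim H)
    (f : G →* H) (hf : Function.Injective f) : GroupFiniteAsdim G := by
  obtain ⟨m, hm, n, hn⟩ := h
  let := MetricSpace.induced f hf m
  exact ⟨_, hm.induced f hf, n, hn.of_isometry f fun _ _ => rfl⟩

theorem GroupFiniteAsdim.of_finite (G : Type*) [Group G] [Finite G] : GroupFiniteAsdim G := by
  obtain ⟨m, hm⟩ := exists_isProperLeftInvariant G
  refine ⟨m, hm, 0, fun r => ?_⟩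
  obtain ⟨D, hD⟩ := (Set.finite_range fun p : G × G => dist p.1 p.2).bddAbove
  refine ⟨D, fun _ => {Set.univ}, fun x => ⟨0, Set.univ, rfl, trivial⟩,
    fun i A _ x _ y _ => hD ⟨(x, y), rfl⟩, ?_⟩
  rintro i _ rfl _ rfl h
  exact absurd rfl h

/-- Two homomorphisms out of the same group with the same kernel have isomorphic images. -/
theorem GroupFiniteAsdim.of_ker_eq {N A B : Type*} [Group N] [Group A] [Group B]
    (hB : GroupFiniteAsdim B) (f : N →* A) (hf : Function.Surjective f) (f' : N →* B)
    (h : f.ker = f'.ker) : GroupFiniteAsdim A := by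
  have h1 : GroupFiniteAsdim (N ⧸ f'.ker) :=
    hB.of_injective (QuotientGroup.kerLift f') (QuotientGroup.kerLift_injective f')
  exact h1.of_injective ((QuotientGroup.quotientKerEquivOfSurjective f hf).symm.trans
    (QuotientGroup.quotientMulEquivOfEq h)).toMonoidHom (MulEquiv.injective _)

/-- A homomorphism from a group with a proper left-invariant metric is bornologous. -/
theorem IsProperLeftInvariant.bornologous {G Q : Type*} [Group G] [Group Q] [MetricSpace G]
    [MetricSpace Q] (hG : IsProperLeftInvariant G) (hQ : IsProperLeftInvariant Q) (f : G →* Q)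
    (r : ℝ) : ∃ s : ℝ, ∀ x y, dist x y ≤ r → dist (f x) (f y) ≤ s := by
  obtain ⟨s, hs⟩ := ((hG.finite_closedBall 1 r).image fun y => dist (f y) 1).bddAbove
  refine ⟨s, fun x y hxy => ?_⟩
  have h1 : dist (y⁻¹ * x) 1 ≤ r := by
    rw [← hG.dist_mul_left y, mul_inv_cancel_left, mul_one]; exact hxy
  have h2 : dist (f (y⁻¹ * x)) 1 ≤ s := hs ⟨_, h1, rfl⟩
  rwa [← hQ.dist_mul_left (f y), ← map_mul, mul_inv_cancel_left, mul_one] at h2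

/-- Preimages of bounded sets under a homomorphism are uniformly close to cosets of the kernel. -/
theorem IsProperLeftInvariant.exists_ker_dist_le {G Q : Type*} [Group G] [Group Q] [MetricSpace G]
    [MetricSpace Q] (hG : IsProperLeftInvariant G) (hQ : IsProperLeftInvariant Q) (f : G →* Q)
    (D : ℝ) : ∃ T : ℝ, ∀ x y, dist (f x) (f y) ≤ D → ∃ k : f.ker, dist y (x * k) ≤ T := by
  classical
  -- A section of `f` over its range. It sends the finite ball of radius `D` to a finite, hence
  -- bounded, set.
  let t : Q → G := fun q => if h : ∃ g, f g = q then h.choose else 1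
  have ht : ∀ g, f (t (f g)) = f g := fun g => by
    have h : ∃ g', f g' = f g := ⟨g, rfl⟩
    simp only [t, dif_pos h]
    exact h.choose_spec
  obtain ⟨T, hT⟩ := ((hQ.finite_closedBall 1 D).image fun q => dist (t q) 1).bddAbove
  refine ⟨T, fun x y hxy => ?_⟩
  have h1 : dist (f (x⁻¹ * y)) 1 ≤ D := by
    rw [← hQ.dist_mul_left (f x), ← map_mul, mul_inv_cancel_left, mul_one, dist_comm]; exact hxy
  have h2 : dist (t (f (x⁻¹ * y))) 1 ≤ T := hT ⟨_, h1, rfl⟩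
  refine ⟨⟨x⁻¹ * y * (t (f (x⁻¹ * y)))⁻¹, ?_⟩, ?_⟩
  · rw [MonoidHom.mem_ker, map_mul, map_inv, ht, mul_inv_cancel]
  · rw [← hG.dist_mul_left (x⁻¹ * y * (t (f (x⁻¹ * y)))⁻¹), ← hG.dist_mul_left x] at h2
    simpa [mul_assoc] using h2

/-- An extension of groups of finite asymptotic dimension has finite asymptotic dimension. -/
theorem GroupFiniteAsdim.of_ker {G Q : Type*} [Group G] [Group Q] [Countable G] (f : G →* Q)
    (hQ : GroupFiniteAsdim Q) (hK : GroupFiniteAsdim f.ker) : GroupFiniteAsdim G := by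
  classical
  obtain ⟨mG, hG⟩ := exists_isProperLeftInvariant G
  obtain ⟨mQ, hQ, m, hm⟩ := hQ
  obtain ⟨n, hn⟩ := hK.exists_asdimLE (hG.induced f.ker.subtype f.ker.subtype_injective)
  refine ⟨mG, hG, _, AsdimLE.of_fintype (Fin (m + 1) × Fin (n + 1)) fun r => ?_⟩
  obtain ⟨s, hs⟩ := hG.bornologous hQ f r
  obtain ⟨D, U, hU1, hU2, hU3⟩ := hm s
  obtain ⟨T, hT⟩ := hG.exists_ker_dist_le hQ f D
  -- Members of the cover of `G` lie within `T` of translates of sets in `V`, so comparing two of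
  -- them costs `2 * T`.
  obtain ⟨E, V, hV1, hV2, hV3⟩ := hn (r + 2 * T)
  -- The default value is harmless: if `B` misses the range of `f`, then `S B A` is empty.
  let c : Set Q → G := fun B => if h : ∃ g, f g ∈ B then h.choose else 1
  have hc : ∀ B g, f g ∈ B → f (c B) ∈ B := fun B g hg => by
    have h : ∃ g, f g ∈ B := ⟨g, hg⟩
    simp only [c, dif_pos h]
    exact h.choose_spec
  let S : Set Q → Set f.ker → Set G := fun B A =>
    {x | f x ∈ B ∧ ∃ a ∈ A, dist x (c B * a) ≤ T}
  refine ⟨E + 2 * T, fun p => Set.image2 S (U p.1) (V p.2), fun x => ?_, ?_, ?_⟩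
  · obtain ⟨i, B, hB, hx⟩ := hU1 (f x)
    obtain ⟨k, hk⟩ := hT (c B) x (hU2 i B hB _ (hc B x hx) _ hx)
    obtain ⟨j, A, hA, hkA⟩ := hV1 k
    exact ⟨(i, j), _, ⟨B, hB, A, hA, rfl⟩, hx, k, hkA, hk⟩
  · rintro ⟨i, j⟩ _ ⟨B, hB, A, hA, rfl⟩ x ⟨hx, a, ha, hxa⟩ y ⟨hy, b, hb, hyb⟩
    have h1 : dist (a : G) b ≤ E := hV2 j A hA a ha b hb
    rw [← hG.dist_mul_left (c B)] at h1
    have h2 := dist_triangle4_right x y (c B * a) (c B * b)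
    linarith
  · rintro ⟨i, j⟩ _ ⟨B, hB, A, hA, rfl⟩ _ ⟨B', hB', A', hA', rfl⟩ hne
      x ⟨hx, a, ha, hxa⟩ y ⟨hy, b, hb, hyb⟩
    by_cases hBB : B = B'
    · subst hBB
      have h1 : r + 2 * T < dist (a : G) b :=
        hV3 j A hA A' hA' (fun h => hne (by rw [h])) a ha b hb
      rw [← hG.dist_mul_left (c B)] at h1
      rw [dist_comm] at hxa hyb
      have h2 := dist_triangle4_right (c B * (a : G)) (c B * b) x y
      linarith
    · by_contra hlt
      exact absurd (hs x y (not_lt.mp hlt)) (not_le.mpr (hU3 i B hB B' hB' hBB _ hx _ hy))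


/-! ### Functoriality of reduced centralizers -/

/-- The map from the centralizer of `g` to the reduced centralizer of `f g`. -/
def centralizerToReduced {G G' : Type*} [Group G] [Group G'] (f : G →* G') (g : G) :
    Subgroup.centralizer ({g} : Set G) →* ReducedCentralizer (f g) :=
  (QuotientGroup.mk' (cyclicInCentralizer (f g))).comp
    ((f.comp (Subgroup.centralizer {g}).subtype).codRestrict _ fun c => by
      have := Subgroup.mem_centralizer_singleton_iff.mp c.2
      rw [Subgroup.mem_centralizer_singleton_iff]
      simp only [MonoidHom.comp_apply, Subgroup.subtype_apply, ← map_mul, this])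

theorem mem_ker_centralizerToReduced {G G' : Type*} [Group G] [Group G'] {f : G →* G'} {g : G}
    {c : Subgroup.centralizer ({g} : Set G)} :
    c ∈ (centralizerToReduced f g).ker ↔ f c ∈ Subgroup.zpowers (f g) := by
  rw [MonoidHom.mem_ker]
  exact (QuotientGroup.eq_one_iff _).trans Subgroup.mem_subgroupOf

theorem cyclicInCentralizer_le_ker {G G' : Type*} [Group G] [Group G'] (f : G →* G') (g : G) :
    cyclicInCentralizer g ≤ (centralizerToReduced f g).ker := by
  intro c hc
  rw [mem_ker_centralizerToReduced]
  obtain ⟨k, hk⟩ := Subgroup.mem_zpowers_iff.mp (Subgroup.mem_subgroupOf.mp hc)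
  exact Subgroup.mem_zpowers_iff.mpr ⟨k, by rw [← map_zpow, hk]⟩

/-- A homomorphism induces homomorphisms of reduced centralizers. -/
def ReducedCentralizer.map {G G' : Type*} [Group G] [Group G'] (f : G →* G') (g : G) :
    ReducedCentralizer g →* ReducedCentralizer (f g) :=
  QuotientGroup.lift _ (centralizerToReduced f g) (cyclicInCentralizer_le_ker f g)

theorem ReducedCentralizer.map_injective {G G' : Type*} [Group G] [Group G'] {f : G →* G'}
    (hf : Function.Injective f) (g : G) : Function.Injective (ReducedCentralizer.map f g) := by
  rw [injective_iff_map_eq_one]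
  intro c
  obtain ⟨c, rfl⟩ := QuotientGroup.mk_surjective c
  intro hc
  obtain ⟨k, hk⟩ := Subgroup.mem_zpowers_iff.mp
    (mem_ker_centralizerToReduced.mp (MonoidHom.mem_ker.mpr hc))
  rw [← map_zpow] at hk
  exact (QuotientGroup.eq_one_iff _).mpr
    (Subgroup.mem_subgroupOf.mpr (Subgroup.mem_zpowers_iff.mpr ⟨k, hf hk⟩))

theorem GroupFiniteAsdim.of_reducedCentralizer_map {G G' : Type*} [Group G] [Group G']
    {f : G →* G'} (hf : Function.Injective f) {g : G}
    (h : GroupFiniteAsdim (ReducedCentralizer (f g))) : GroupFiniteAsdim (ReducedCentralizer g) :=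
  h.of_injective _ (ReducedCentralizer.map_injective hf g)

theorem GroupFiniteAsdim.reducedCentralizer_one {G : Type*} [Group G] (h : GroupFiniteAsdim G) :
    GroupFiniteAsdim (ReducedCentralizer (1 : G)) := by
  have h1 : GroupFiniteAsdim (Subgroup.centralizer ({1} : Set G)) :=
    h.of_injective _ (Subgroup.subtype_injective _)
  refine h1.of_ker_eq (QuotientGroup.mk' _) (QuotientGroup.mk'_surjective _) (MonoidHom.id _) ?_
  rw [QuotientGroup.ker_mk']
  ext c
  simp [cyclicInCentralizer]

/-! ### Subgroups and extensions -/

/-- The conjecture passes to subgroups of a group of finite asymptotic dimension. -/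
theorem SatisfiesCentralizerConjecture.subgroup {G : Type*} [Group G] (hG : GroupFiniteAsdim G)
    (h : SatisfiesCentralizerConjecture G) (H : Subgroup G) :
    SatisfiesCentralizerConjecture H :=
  fun _ g => .of_reducedCentralizer_map H.subtype_injective (h hG (H.subtype g))

/-- The intersection of a cyclic group with the range of an injective homomorphism is the image
of a cyclic group. -/
theorem exists_mem_zpowers_iff_of_injective {K G : Type*} [Group K] [Group G] {f : K →* G}
    (hf : Function.Injective f) (g : G) :
    ∃ k : K, ∀ x, f x ∈ Subgroup.zpowers g ↔ x ∈ Subgroup.zpowers k := by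
  have h : IsCyclic ((Subgroup.zpowers g).comap f) :=
    isCyclic_of_injective (f.subgroupComap (Subgroup.zpowers g))
      fun x y hxy => Subtype.ext (hf (congrArg Subtype.val hxy))
  obtain ⟨k, hk⟩ := (Subgroup.isCyclic_iff_exists_zpowers_eq_top _).mp h
  exact ⟨k, fun x => by rw [hk, Subgroup.mem_comap]⟩

/-- The conjecture for extensions. -/
theorem SatisfiesCentralizerConjecture.of_groupExtension {K G Q : Type*} [Group K] [Group G]
    [Group Q] [Countable G] (S : GroupExtension K G Q) (hQ : GroupFiniteAsdim Q)
    (cK : SatisfiesCentralizerConjecture K) (cQ : SatisfiesCentralizerConjecture Q) :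
    SatisfiesCentralizerConjecture G := by
  intro hG g
  have hK : GroupFiniteAsdim K := hG.of_injective S.inl S.inl_injective
  obtain ⟨k, hk⟩ := exists_mem_zpowers_iff_of_injective S.inl_injective g
  have : Countable (ReducedCentralizer g) := Quotient.countable
  refine GroupFiniteAsdim.of_ker (ReducedCentralizer.map S.rightHom g) (cQ hQ _) ?_
  let N : Subgroup K := (Subgroup.centralizer {g}).comap S.inl
  -- The image of `k` is a power of `g`, so whatever commutes with `g` commutes with it.
  have hN : ∀ x : N, (x : K) ∈ Subgroup.centralizer {k} := fun x => by
    obtain ⟨m, hm⟩ := Subgroup.mem_zpowers_iff.mp ((hk k).mpr (Subgroup.mem_zpowers k))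
    have hx : Commute (S.inl x) g := Subgroup.mem_centralizer_singleton_iff.mp x.2
    refine Subgroup.mem_centralizer_singleton_iff.mpr (S.inl_injective ?_)
    rw [map_mul, map_mul, ← hm]
    exact (hx.zpow_right m).eq
  let f' : N →* ReducedCentralizer k :=
    (QuotientGroup.mk' (cyclicInCentralizer k)).comp (N.subtype.codRestrict _ hN)
  let f₀ : N →* ReducedCentralizer g :=
    (QuotientGroup.mk' (cyclicInCentralizer g)).comp
      ((S.inl.comp N.subtype).codRestrict _ fun x => x.2)
  have hker : ∀ x : K, S.rightHom (S.inl x) = 1 := fun x => by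
    rw [← MonoidHom.mem_ker, ← S.range_inl_eq_ker_rightHom]
    exact ⟨x, rfl⟩
  let f : N →* (ReducedCentralizer.map S.rightHom g).ker := f₀.codRestrict _ fun x =>
    mem_ker_centralizerToReduced.mpr ((hker x).symm ▸ one_mem _)
  refine (cK hK k).of_ker_eq f ?_ f' ?_
  · rintro ⟨c, hc⟩
    obtain ⟨c, rfl⟩ := QuotientGroup.mk_surjective c
    obtain ⟨m, hm⟩ := Subgroup.mem_zpowers_iff.mp (mem_ker_centralizerToReduced.mp hc)
    -- Dividing by a power of `g` moves `c` into the image of `K` without changing its class.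
    have h1 : (c : G) * g ^ (-m) ∈ S.inl.range := by
      rw [S.range_inl_eq_ker_rightHom, MonoidHom.mem_ker, map_mul, ← hm, map_zpow, ← zpow_add]
      simp
    obtain ⟨x, hx⟩ := h1
    have hg : g ∈ Subgroup.centralizer {g} := Subgroup.mem_centralizer_singleton_iff.mpr rfl
    refine ⟨⟨x, ?_⟩, Subtype.ext (QuotientGroup.eq.mpr ?_)⟩
    · rw [Subgroup.mem_comap, hx]
      exact mul_mem c.2 (zpow_mem hg _)
    · refine Subgroup.mem_subgroupOf.mpr ?_
      change (S.inl x)⁻¹ * c ∈ _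
      rw [hx]
      simp
  · ext x
    have h1 : x ∈ f.ker ↔ S.inl x ∈ Subgroup.zpowers g := by
      rw [MonoidHom.mem_ker, Subtype.ext_iff]
      exact (QuotientGroup.eq_one_iff _).trans Subgroup.mem_subgroupOf
    have h2 : x ∈ f'.ker ↔ (x : K) ∈ Subgroup.zpowers k := by
      rw [MonoidHom.mem_ker]
      exact (QuotientGroup.eq_one_iff _).trans Subgroup.mem_subgroupOf
    rw [h1, h2, hk]


/-! ### Reduced words in free products -/

namespace Monoid.CoprodI

variable {ι : Type*} {H : ι → Type*} [∀ i, Group (H i)]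

/-- The product in the free product of a list of letters. -/
def listProd (l : List (Σ i, H i)) : CoprodI H := (l.map fun a => of a.2).prod

@[simp]
theorem listProd_nil : listProd ([] : List (Σ i, H i)) = 1 := rfl

@[simp]
theorem listProd_cons (a : Σ i, H i) (l : List (Σ i, H i)) :
    listProd (a :: l) = of a.2 * listProd l := List.prod_cons

@[simp]
theorem listProd_append (l m : List (Σ i, H i)) :
    listProd (l ++ m) = listProd l * listProd m := by
  simp [listProd]

/-- A list of letters is reduced if it has no trivial letters and adjacent letters lie in
different factors. -/
def IsReduced (l : List (Σ i, H i)) : Prop :=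
  (∀ a ∈ l, a.2 ≠ 1) ∧ l.IsChain fun a b => a.1 ≠ b.1

theorem isReduced_nil : IsReduced ([] : List (Σ i, H i)) := ⟨by simp, List.isChain_nil⟩

theorem isReduced_cons {a : Σ i, H i} {l : List (Σ i, H i)} :
    IsReduced (a :: l) ↔ a.2 ≠ 1 ∧ (∀ b ∈ l.head?, a.1 ≠ b.1) ∧ IsReduced l := by
  simp only [IsReduced, List.isChain_cons, List.forall_mem_cons]
  tauto

theorem isReduced_append {l m : List (Σ i, H i)} :
    IsReduced (l ++ m) ↔
      IsReduced l ∧ IsReduced m ∧ ∀ a ∈ l.getLast?, ∀ b ∈ m.head?, a.1 ≠ b.1 := by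
  simp only [IsReduced, List.isChain_append, List.forall_mem_append]
  tauto

/-- Uniqueness of normal forms, transported from `Word.equiv`. -/
theorem IsReduced.eq_of_listProd_eq {l m : List (Σ i, H i)} (hl : IsReduced l) (hm : IsReduced m)
    (h : listProd l = listProd m) : l = m := by
  classical
  have := (Word.equiv (M := H)).symm.injective
    (a₁ := ⟨l, hl.1, hl.2⟩) (a₂ := ⟨m, hm.1, hm.2⟩) h
  exact congrArg Word.toList this

/-- Every list can be reduced, which makes it shorter unless it was reduced before. -/
theorem exists_isReduced (l : List (Σ i, H i)) :
    ∃ r, IsReduced r ∧ listProd r = listProd l ∧ (r = l ∨ r.length < l.length) := by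
  classical
  induction l with
  | nil => exact ⟨[], isReduced_nil, rfl, Or.inl rfl⟩
  | cons a l ih =>
    obtain ⟨r, hr, hp, hlen⟩ := ih
    have hlen' : r.length ≤ l.length := by
      rcases hlen with rfl | h
      exacts [le_rfl, h.le]
    by_cases ha : a.2 = 1
    · exact ⟨r, hr, by simp [hp, ha], Or.inr (by simp; omega)⟩
    by_cases hb : ∀ b ∈ r.head?, a.1 ≠ b.1
    · refine ⟨a :: r, isReduced_cons.mpr ⟨ha, hb, hr⟩, by simp [hp], ?_⟩
      rcases hlen with rfl | h
      exacts [Or.inl rfl, Or.inr (by simpa using h)]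
    · push Not at hb
      obtain ⟨b, hb, hab⟩ := hb
      obtain ⟨i, a⟩ := a
      obtain ⟨j, b⟩ := b
      obtain rfl : i = j := hab
      cases r with
      | nil => simp at hb
      | cons c r =>
        obtain rfl : c = ⟨i, b⟩ := by simpa using hb
        obtain ⟨h1, h2, h3⟩ := isReduced_cons.mp hr
        have hp' : listProd l = of b * listProd r := by rw [← hp, listProd_cons]
        simp only [List.length_cons] at hlen'
        by_cases hab : a * b = 1
        · refine ⟨r, h3, ?_, Or.inr (by simp; omega)⟩
          rw [listProd_cons, hp', ← mul_assoc, ← map_mul, hab, map_one, one_mul]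
        · refine ⟨⟨i, a * b⟩ :: r, isReduced_cons.mpr ⟨hab, h2, h3⟩, ?_, Or.inr (by simp; omega)⟩
          rw [listProd_cons, listProd_cons, hp', map_mul, mul_assoc]

theorem exists_isReduced_listProd_eq (x : CoprodI H) :
    ∃ l : List (Σ i, H i), IsReduced l ∧ listProd l = x := by
  classical
  let w : Word H := Word.equiv x
  exact ⟨w.toList, ⟨w.ne_one, w.chain_ne⟩, Word.equiv.symm_apply_apply x⟩

/-- A reduced list equals any list with the same product which is not longer. -/
theorem IsReduced.eq_of_length_le {l m : List (Σ i, H i)} (hl : IsReduced l)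
    (h : listProd l = listProd m) (hlen : m.length ≤ l.length) : l = m := by
  obtain ⟨r, hr, hp, h1⟩ := exists_isReduced m
  obtain rfl := hl.eq_of_listProd_eq hr (h.trans hp.symm)
  exact h1.resolve_right hlen.not_gt

/-- The formal inverse of a list of letters. -/
def listInv (l : List (Σ i, H i)) : List (Σ i, H i) :=
  (l.map fun a => (⟨a.1, a.2⁻¹⟩ : Σ i, H i)).reverse

@[simp]
theorem listInv_cons (a : Σ i, H i) (l : List (Σ i, H i)) :
    listInv (a :: l) = listInv l ++ [⟨a.1, a.2⁻¹⟩] := by simp [listInv]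

@[simp]
theorem listInv_append (l m : List (Σ i, H i)) :
    listInv (l ++ m) = listInv m ++ listInv l := by simp [listInv]

@[simp]
theorem listInv_listInv (l : List (Σ i, H i)) : listInv (listInv l) = l := by
  simp [listInv, Function.comp_def]

@[simp]
theorem length_listInv (l : List (Σ i, H i)) : (listInv l).length = l.length := by
  simp [listInv]

@[simp]
theorem listProd_listInv (l : List (Σ i, H i)) : listProd (listInv l) = (listProd l)⁻¹ := by
  induction l with
  | nil => simp [listInv]
  | cons a l ih => simp [ih]

theorem IsReduced.inv {l : List (Σ i, H i)} (hl : IsReduced l) : IsReduced (listInv l) := by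
  refine ⟨?_, ?_⟩
  · intro a ha
    simp only [listInv, List.mem_reverse, List.mem_map] at ha
    obtain ⟨b, hb, rfl⟩ := ha
    exact inv_ne_one.mpr (hl.1 b hb)
  · rw [listInv, List.isChain_reverse, List.isChain_map]
    exact hl.2.imp fun _ _ h => h.symm

/-! ### Cyclically reduced words and centralizers -/

/-- A nonempty reduced list is cyclically reduced if its square is reduced. -/
def IsCyclicallyReduced (w : List (Σ i, H i)) : Prop := w ≠ [] ∧ IsReduced (w ++ w)

theorem IsCyclicallyReduced.inv {w : List (Σ i, H i)} (hw : IsCyclicallyReduced w) :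
    IsCyclicallyReduced (listInv w) := by
  refine ⟨fun h => hw.1 ?_, listInv_append w w ▸ hw.2.inv⟩
  rw [← listInv_listInv w, h]
  rfl

theorem IsCyclicallyReduced.rotate {a : Σ i, H i} {w : List (Σ i, H i)}
    (hw : IsCyclicallyReduced (a :: w)) : IsCyclicallyReduced (w ++ [a]) := by
  -- The square of a single letter is never reduced.
  have hne : w ≠ [] := by
    rintro rfl
    exact (isReduced_cons.mp hw.2).2.1 a (by simp) rfl
  obtain ⟨h1, h2, h3⟩ := isReduced_append.mp hw.2
  refine ⟨by simp, ?_⟩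
  have h4 : IsReduced (w ++ a :: w) := (isReduced_cons.mp hw.2).2.2
  have h5 : w ++ [a] ++ (w ++ [a]) = (w ++ a :: w) ++ [a] := by simp
  rw [h5, isReduced_append]
  refine ⟨h4, isReduced_cons.mpr ⟨h1.1 a (by simp), by simp, isReduced_nil⟩, ?_⟩
  intro b hb c hc
  obtain rfl : a = c := by simpa using hc
  refine h3 b ?_ a (by simp)
  obtain ⟨v, d, rfl⟩ := List.eq_nil_or_concat' w |>.resolve_left hne
  simpa [List.getLast?_append, List.getLast?_cons] using hb

/-- `x` is a power of the product of `w` times the product of a prefix of `w`. -/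
def IsPowMulPrefix (w : List (Σ i, H i)) (x : CoprodI H) : Prop :=
  ∃ (k : ℤ) (s t : List (Σ i, H i)), w = s ++ t ∧ x = listProd w ^ k * listProd s

/-- If `w⁻¹ = s t`, then `s = w⁻¹ t⁻¹`, and `t⁻¹` is a prefix of `w`. -/
theorem IsPowMulPrefix.of_listInv {w : List (Σ i, H i)} {x : CoprodI H}
    (h : IsPowMulPrefix (listInv w) x) : IsPowMulPrefix w x := by
  obtain ⟨k, s, t, hw, rfl⟩ := h
  have hw' : w = listInv t ++ listInv s := by rw [← listInv_append, ← hw, listInv_listInv]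
  refine ⟨-k - 1, listInv t, listInv s, hw', ?_⟩
  rw [listProd_listInv, inv_zpow', sub_eq_add_neg, zpow_add, zpow_neg_one, mul_assoc]
  congr 1
  rw [hw']
  simp

/-- Conjugation by `a` carries the rotated product to the original one, and a proper prefix `s`
becomes `a :: s`. -/
theorem IsPowMulPrefix.of_rotate {a : Σ i, H i} {w : List (Σ i, H i)} {x : CoprodI H}
    (h : IsPowMulPrefix (w ++ [a]) x) : IsPowMulPrefix (a :: w) (of a.2 * x) := by
  obtain ⟨k, s, t, hw, rfl⟩ := h
  have hconj : ∀ k : ℤ, of a.2 * listProd (w ++ [a]) ^ k = listProd (a :: w) ^ k * of a.2 := by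
    intro k
    have h1 : SemiconjBy (of a.2) (listProd (w ++ [a])) (listProd (a :: w)) := by
      simp [SemiconjBy, mul_assoc]
    exact h1.zpow_right k
  rw [← mul_assoc, hconj, mul_assoc]
  rcases List.eq_nil_or_concat' t with rfl | ⟨t, b, rfl⟩
  -- When the prefix is the whole rotated word, prepending `a` wraps around: one more power and the
  -- prefix `[a]`.
  · rw [List.append_nil] at hw
    subst hw
    refine ⟨k + 1, [a], w, rfl, ?_⟩
    rw [zpow_add_one, mul_assoc]
    simp [mul_assoc]
  · rw [← List.append_assoc] at hw
    obtain ⟨rfl, h⟩ := List.append_inj' hw rfl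
    exact ⟨k, a :: s, t, rfl, by simp⟩

/-- An element which conjugates a cyclically reduced list into a list that is not longer is a
power of its product times the product of a prefix. -/
theorem IsCyclicallyReduced.isPowMulPrefix (x : List (Σ i, H i)) (hx : IsReduced x)
    (w v : List (Σ i, H i)) (hw : IsCyclicallyReduced w) (hv : v.length ≤ w.length)
    (h : listProd w * listProd x = listProd x * listProd v) :
    IsPowMulPrefix w (listProd x) := by
  -- Stripping a letter of `x` rotates `w` but leaves `v` alone, so the two cannot be kept equal.
  induction x generalizing w v with
  | nil => exact ⟨0, [], w, rfl, by simp⟩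
  | cons b x ih =>
    -- If `w x` has no cancellation or merging, it is reduced and no shorter than `x v`, so the two
    -- lists coincide. Hence `w` begins with `b`, which can be stripped from `x` while rotating `w`.
    have key : ∀ w v : List (Σ i, H i), IsCyclicallyReduced w → v.length ≤ w.length →
        listProd w * listProd (b :: x) = listProd (b :: x) * listProd v →
        (∀ a ∈ w.getLast?, a.1 ≠ b.1) → IsPowMulPrefix w (listProd (b :: x)) := by
      intro w v hw hv h hlast
      obtain ⟨a, w, rfl⟩ := List.exists_cons_of_ne_nil hw.1
      have h1 : IsReduced ((a :: w) ++ (b :: x)) :=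
        isReduced_append.mpr ⟨(isReduced_append.mp hw.2).1, hx, fun c hc d hd => by
          obtain rfl : b = d := by simpa using hd
          exact hlast c hc⟩
      have h2 : (a :: w) ++ (b :: x) = (b :: x) ++ v :=
        h1.eq_of_length_le (by rw [listProd_append, listProd_append, h]) (by
          simp only [List.length_append, List.length_cons] at hv ⊢; omega)
      obtain rfl : a = b := by simpa using (List.cons.inj h2).1
      rw [listProd_cons]
      refine (ih (isReduced_cons.mp hx).2.2 (w ++ [a]) v hw.rotate (by simpa using hv) ?_).of_rotate
      simpa [mul_assoc] using h
    by_cases hlast : ∀ a ∈ w.getLast?, a.1 ≠ b.1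
    · exact key w v hw hv h hlast
    · push Not at hlast
      obtain ⟨a, ha, hab⟩ := hlast
      -- Otherwise the last letter of `w` is in the factor of `b`. The first is then in another
      -- factor, and its inverse ends `w⁻¹`.
      refine (key (listInv w) (listInv v) hw.inv (by simpa using hv) ?_ ?_).of_listInv
      · rw [listProd_listInv, listProd_listInv, inv_mul_eq_iff_eq_mul, ← mul_assoc,
          eq_mul_inv_iff_mul_eq, h]
      · intro c hc
        rw [listInv, List.getLast?_reverse, List.head?_map] at hc
        obtain ⟨d, hd, rfl⟩ := Option.map_eq_some_iff.mp hc
        change d.1 ≠ b.1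
        rw [← hab]
        exact ((isReduced_append.mp hw.2).2.2 a ha d hd).symm

/-- Every element of a free product is conjugate to an element of a factor, or to the product of
a cyclically reduced list, or is trivial. -/
theorem exists_conj_eq (l : List (Σ i, H i)) (hl : IsReduced l) :
    ∃ x : CoprodI H, x * listProd l * x⁻¹ = 1 ∨ (∃ i, ∃ h : H i, h ≠ 1 ∧
      x * listProd l * x⁻¹ = of h) ∨ ∃ w, IsCyclicallyReduced w ∧
      x * listProd l * x⁻¹ = listProd w := by
  classical
  induction hn : l.length using Nat.strong_induction_on generalizing l with
  | _ n ih =>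
    subst hn
    rcases l with _ | ⟨⟨i, a⟩, l⟩
    · exact ⟨1, Or.inl (by simp)⟩
    rcases List.eq_nil_or_concat' l with rfl | ⟨m, ⟨j, b⟩, rfl⟩
    · exact ⟨1, Or.inr (Or.inl ⟨i, a, hl.1 _ List.mem_cons_self, by simp⟩)⟩
    by_cases hij : j = i
    · subst hij
      obtain ⟨h1, h2, h3⟩ := isReduced_cons.mp hl
      obtain ⟨h4, h5, h6⟩ := isReduced_append.mp h3
      -- Conjugating by `b` brings the last letter to the front, where it merges with `a` and
      -- shortens the word.
      suffices hs : ∃ r, IsReduced r ∧ r.length < (⟨j, a⟩ :: (m ++ [⟨j, b⟩]) :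
          List (Σ i, H i)).length ∧ listProd r = of (b * a) * listProd m by
        obtain ⟨r, hr, hlen, hp⟩ := hs
        obtain ⟨x, hx⟩ := ih _ hlen r hr rfl
        have he : x * of b * listProd (⟨j, a⟩ :: (m ++ [⟨j, b⟩])) * (x * of b)⁻¹ =
            x * listProd r * x⁻¹ := by
          rw [hp]
          simp [mul_assoc]
        exact ⟨x * of b, by rwa [he]⟩
      by_cases hba : b * a = 1
      · exact ⟨m, h4, by simp, by simp [hba]⟩
      · refine ⟨⟨j, b * a⟩ :: m, isReduced_cons.mpr ⟨hba, ?_, h4⟩, by simp, by simp⟩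
        intro c hc
        exact h2 c (by simp_all)
    · refine ⟨1, Or.inr (Or.inr ⟨_, ⟨by simp, isReduced_append.mpr ⟨hl, hl, ?_⟩⟩, by simp⟩)⟩
      intro c hc d hd
      rw [← List.cons_append, List.getLast?_concat] at hc
      obtain rfl := Option.some.inj hc
      obtain rfl := Option.some.inj hd
      exact hij

/-- Left and right multiplication by letters of a factor agree only on elements of the factor. -/
theorem eq_nil_of_of_mul_eq {i : ι} {h h' : H i} (h1 : h ≠ 1) {x : List (Σ i, H i)}
    (hx : IsReduced x) (hi : ∀ b ∈ x.head?, i ≠ b.1) (he : of h * listProd x = listProd x * of h') :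
    x = [] := by
  have h2 : IsReduced ((⟨i, h⟩ : Σ i, H i) :: x) := isReduced_cons.mpr ⟨h1, hi, hx⟩
  -- Both sides have equal length and the left one is reduced, so a nonempty `x` would begin with a
  -- letter of factor `i`.
  have h3 := h2.eq_of_length_le (m := x ++ [⟨i, h'⟩]) (by simpa using he) (by simp)
  cases x with
  | nil => rfl
  | cons b x =>
    refine absurd ?_ (hi b (by simp))
    rw [← (List.cons.inj h3).1]

/-- The centralizer of a nontrivial element of a factor is contained in the factor. -/
theorem mem_range_of_of_commute {i : ι} {h : H i} (h1 : h ≠ 1) {x : CoprodI H}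
    (hx : Commute x (of h)) : ∃ y : H i, of y = x := by
  obtain ⟨l, hl, rfl⟩ := exists_isReduced_listProd_eq x
  by_cases hi : ∀ b ∈ l.head?, i ≠ b.1
  · obtain rfl := eq_nil_of_of_mul_eq h1 hl hi hx.eq.symm
    exact ⟨1, by simp⟩
  · push Not at hi
    obtain ⟨⟨j, b⟩, hb, rfl⟩ := hi
    cases l with
    | nil => simp at hb
    | cons c l =>
      obtain rfl : c = ⟨_, b⟩ := by simpa using hb
      obtain ⟨-, h3, h4⟩ := isReduced_cons.mp hl
      -- Stripping the leading letter `b` replaces `h` on the left by its conjugate, and the rest of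
      -- the word no longer begins in this factor.
      have h5 : b⁻¹ * h * b ≠ 1 := fun h => h1 (by
        simpa using (conj_eq_one_iff (a := b⁻¹)).mp (by simpa using h))
      obtain rfl := eq_nil_of_of_mul_eq (h' := h) h5 h4 h3 (by
        have := hx.eq
        rw [listProd_cons, mul_assoc] at this
        rw [map_mul, map_mul, map_inv, mul_assoc, mul_assoc, inv_mul_eq_iff_eq_mul, this])
      exact ⟨b, by simp⟩

/-- Each class is represented by a prefix product, and there are only `w.length + 1` prefixes. -/
theorem finite_reducedCentralizer {w : List (Σ i, H i)} (hw : IsCyclicallyReduced w) :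
    Finite (ReducedCentralizer (listProd w)) := by
  classical
  have key : ∀ c : ReducedCentralizer (listProd w), ∃ n : Fin (w.length + 1),
      ∃ d : Subgroup.centralizer {listProd w}, (QuotientGroup.mk d : ReducedCentralizer _) = c ∧
        (d : CoprodI H) = listProd (w.take n) := by
    intro c
    obtain ⟨c, rfl⟩ := QuotientGroup.mk_surjective c
    obtain ⟨x, hx, hxc⟩ := exists_isReduced_listProd_eq (c : CoprodI H)
    have hc : (c : CoprodI H) * listProd w = listProd w * c :=
      Subgroup.mem_centralizer_singleton_iff.mp c.2
    obtain ⟨k, s, t, hst, h⟩ := hw.isPowMulPrefix x hx w w le_rfl (by rw [hxc, hc])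
    have hs : (listProd w) ^ (-k) * (c : CoprodI H) = listProd s := by
      rw [← hxc, h, zpow_neg, inv_mul_cancel_left]
    have hg : listProd w ∈ Subgroup.centralizer {listProd w} :=
      Subgroup.mem_centralizer_singleton_iff.mpr rfl
    refine ⟨⟨s.length, by rw [hst]; simp⟩,
      ⟨listProd w ^ (-k) * c, mul_mem (zpow_mem hg _) c.2⟩, ?_, ?_⟩
    · rw [QuotientGroup.eq]
      refine Subgroup.mem_subgroupOf.mpr (Subgroup.mem_zpowers_iff.mpr ⟨k, ?_⟩)
      have hcom : Commute (c : CoprodI H) (listProd w ^ k) := Commute.zpow_right hc k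
      change _ = (listProd w ^ (-k) * (c : CoprodI H))⁻¹ * c
      rw [zpow_neg, mul_inv_rev, inv_inv, mul_assoc, ← hcom.eq, inv_mul_cancel_left]
    · refine hs.trans (congrArg listProd ?_)
      exact (List.take_left' rfl).symm.trans (congrArg (List.take s.length) hst.symm)
  choose n d hd hn using key
  refine Finite.of_injective n fun a b hab => ?_
  rw [← hd a, ← hd b]
  congr 1
  exact Subtype.ext (by rw [hn, hn, hab])

end Monoid.CoprodI

/-! ### Free products and the main theorem -/

open Monoid in
/-- The conjecture for free products. -/
theorem SatisfiesCentralizerConjecture.coprodI {ι : Type*} {H : ι → Type*} [∀ i, Group (H i)]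
    (cH : ∀ i, SatisfiesCentralizerConjecture (H i)) :
    SatisfiesCentralizerConjecture (CoprodI H) := by
  intro hG g
  obtain ⟨l, hl, rfl⟩ := CoprodI.exists_isReduced_listProd_eq g
  obtain ⟨x, hx⟩ := CoprodI.exists_conj_eq l hl
  refine .of_reducedCentralizer_map (f := (MulAut.conj x).toMonoidHom) (MulEquiv.injective _) ?_
  change GroupFiniteAsdim (ReducedCentralizer (x * CoprodI.listProd l * x⁻¹))
  rcases hx with hx | ⟨i, h, h1, hx⟩ | ⟨w, hw, hx⟩
  · rw [hx]
    exact hG.reducedCentralizer_one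
  · rw [hx]
    have hinj : Function.Injective (CoprodI.of : H i →* CoprodI H) := CoprodI.of_injective i
    refine (cH i (hG.of_injective _ hinj) h).of_injective
      (MulEquiv.ofBijective (ReducedCentralizer.map (CoprodI.of : H i →* CoprodI H) h)
        ⟨ReducedCentralizer.map_injective hinj h, fun c => ?_⟩).symm.toMonoidHom
      (MulEquiv.injective _)
    obtain ⟨⟨c, hc⟩, rfl⟩ := QuotientGroup.mk_surjective c
    have hc' : Commute c (CoprodI.of h) := Subgroup.mem_centralizer_singleton_iff.mp hc
    obtain ⟨y, rfl⟩ := CoprodI.mem_range_of_of_commute h1 hc'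
    refine ⟨QuotientGroup.mk ⟨y, Subgroup.mem_centralizer_singleton_iff.mpr (hinj ?_)⟩, rfl⟩
    rw [map_mul, map_mul]
    exact hc'.eq
  · rw [hx]
    have := CoprodI.finite_reducedCentralizer hw
    exact .of_finite _

theorem mainTheorem5 :
    (∀ (G : Type*) [Group G] [Countable G],
      GroupFiniteAsdim G → SatisfiesCentralizerConjecture G →
        ∀ H : Subgroup G, SatisfiesCentralizerConjecture H) ∧
    (∀ (ι : Type*) (H : ι → Type*) [∀ i, Group (H i)] [Countable (Monoid.CoprodI H)],
      (∀ i, SatisfiesCentralizerConjecture (H i)) →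
        SatisfiesCentralizerConjecture (Monoid.CoprodI H)) ∧
    (∀ (K G Q : Type*) [Group K] [Group G] [Group Q] [Countable G]
      (_S : GroupExtension K G Q),
        GroupFiniteAsdim Q →
        SatisfiesCentralizerConjecture K → SatisfiesCentralizerConjecture Q →
        SatisfiesCentralizerConjecture G) :=
  ⟨fun _ _ _ hG h H => h.subgroup hG H, fun _ _ _ _ cH => .coprodI cH,
    fun _ _ _ _ _ _ _ S hQ cK cQ => .of_groupExtension S hQ cK cQ⟩
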